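/- For a nonzero polynomial $P\in\mathbb{Z}[x]$ let $M(P)=\exp\big(\frac1{2\pi}\int_0^{2\pi}\log|P(e^{it})|\,dt\big)$ be its Mahler measure, let $P^{-1}(0)$ be its set of complex zeros, and let $$K(P)=\min\big(|P^{-1}(0)\cap\{|x-1|<1\}|,\ |P^{-1}(0)\cap\{|x+1|<1\}|\big).$$ Put $C=\frac{2}{\pi}\log\frac{1+\sqrt5}{2}$, and let $\phi:\mathbb{N}\to\mathbb{R}$ be a function with $\phi(d)=o(d/\log d)$ as $d\to\infty$. Theorem. For every $\varepsilon>0$ there is $D_0$, depending only on $\varepsilon$ and $\phi$, such that every monic irreducible $P\in\mathbb{Z}[x]$ of degree $d\ge D_0$ with $0<\log M(P)\le\phi(d)$ satisfies $$|P^{-1}(0)\cap\{|x-1|<1\}|\ \ge\ (C-\varepsilon)\sqrt{\frac{d}{\log d\,\log M(P)}},$$ and, if moreover $\varepsilon<C$, then $K(P)\ge 1$ and $$\log M(P)\ \ge\ (C-\varepsilon)^2\,\frac{d}{K(P)^2\log d}.$$ -/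

import Mathlib

noncomputable section

/-- The Mahler measure of an integer polynomial, regarded as a complex polynomial:
`exp ((1 / 2π) ∫₀^{2π} log |P (exp (i t))| dt)` for `P ≠ 0`. -/
def intMahlerMeasure (P : Polynomial ℤ) : ℝ :=
  (P.map (Int.castRingHom ℂ)).mahlerMeasure

/-- The set of complex zeros of `P` in the open disc of centre `c` and radius `1`. -/
def zerosNear (P : Polynomial ℤ) (c : ℂ) : Set ℂ :=
  {z : ℂ | Polynomial.aeval z P = 0 ∧ ‖z - c‖ < 1}

/-- The zero set is finite for `P ≠ 0`, so that its `Set.ncard` is its true cardinality. -/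
theorem zerosNear_finite (P : Polynomial ℤ) (hP : P ≠ 0) (c : ℂ) : (zerosNear P c).Finite :=
  (P.rootSet_finite ℂ).subset fun _ hz =>
    Polynomial.mem_rootSet.2 ⟨hP, hz.1⟩

/-- The smaller of the numbers of zeros of `P` in `{|x - 1| < 1}` and in `{|x + 1| < 1}`. -/
def minZeroCount (P : Polynomial ℤ) : ℕ :=
  min (zerosNear P 1).ncard (zerosNear P (-1)).ncard

/-- The constant `(2 / π) log ((1 + √5) / 2)`. -/
def goldenConst : ℝ :=
  2 / Real.pi * Real.log ((1 + Real.sqrt 5) / 2)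

end

/-! The proof gives more than is asked: once log M(P) ≤ ηd, each of the two discs contains at least
κd zeros, with κ, η > 0 absolute. Indeed, let Q ∈ ℤ[x] satisfy |Q| < 1 on the part of the unit
circle outside the disc. As |Res(P, Q)| ≥ 1, the values log|Q(a)| over the zeros a of P have
nonnegative sum. Zeros far from the disc and close to the unit circle contribute at most -A < 0
each, and small Mahler measure limits both the number of zeros off the circle and the size of Q
there. So a positive proportion of zeros must lie in the disc (`exists_linear_zero_count`). A
product of cyclotomic polynomials serves as Q, and Q(-x) serves for the other disc.

What remains is κ²·d·log M(P) ≥ 1 for large d. A weak form of Dobrowolski's theorem suffices: log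
M(P) > 1/(2m³) with m ≈ d^(1/4) (`eventually_one_lt_mul_log_intMahlerMeasure`). Pigeonhole gives a
polynomial F with coefficients in {-1, 0, 1}, divisible by P⁷; for some prime p in (m, m²] the
product of F(a^p) is nonzero, hence at least p^(7d), which contradicts the upper bound if M(P) is
too close to 1. The value of C enters only through 0 ≤ C ≤ 1. -/

open Polynomial

/-! ### Zeros, resultants and conjugation -/

/-- The finite set of complex zeros of an integer polynomial. -/
noncomputable def complexZeros (P : ℤ[X]) : Finset ℂ :=
  (P.map (Int.castRingHom ℂ)).roots.toFinset

theorem mem_complexZeros {P : ℤ[X]} (hP : P ≠ 0) {z : ℂ} :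
    z ∈ complexZeros P ↔ aeval z P = 0 := by
  have : P.map (Int.castRingHom ℂ) ≠ 0 :=
    (Polynomial.map_ne_zero_iff Int.cast_injective).2 hP
  rw [complexZeros, Multiset.mem_toFinset, mem_roots this, IsRoot.def, eval_map, aeval_def]
  rfl

theorem nodup_roots_of_monic_irreducible {P : ℤ[X]} (hm : P.Monic) (hi : Irreducible P) :
    (P.map (Int.castRingHom ℂ)).roots.Nodup := by
  have h1 : Irreducible (P.map (algebraMap ℤ ℚ)) :=
    (hm.irreducible_iff_irreducible_map_fraction_map).1 hi
  have h2 := h1.separable.map (f := algebraMap ℚ ℂ)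
  rw [Polynomial.map_map] at h2
  have : (algebraMap ℚ ℂ).comp (algebraMap ℤ ℚ) = Int.castRingHom ℂ := RingHom.ext_int _ _
  rw [this] at h2
  exact nodup_roots h2

theorem prod_complexZeros {M : Type*} [CommMonoid M] {P : ℤ[X]} (hm : P.Monic)
    (hi : Irreducible P) (f : ℂ → M) :
    ∏ a ∈ complexZeros P, f a = ((P.map (Int.castRingHom ℂ)).roots.map f).prod := by
  rw [Finset.prod, complexZeros, Multiset.toFinset_val,
    (nodup_roots_of_monic_irreducible hm hi).dedup]

theorem card_complexZeros {P : ℤ[X]} (hm : P.Monic) (hi : Irreducible P) :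
    (complexZeros P).card = P.natDegree := by
  rw [complexZeros, Multiset.toFinset_card_of_nodup (nodup_roots_of_monic_irreducible hm hi),
    ← (IsAlgClosed.splits _).natDegree_eq_card_roots, hm.natDegree_map]

theorem map_eq_prod_complexZeros {P : ℤ[X]} (hm : P.Monic) (hi : Irreducible P) :
    P.map (Int.castRingHom ℂ) = ∏ a ∈ complexZeros P, (X - C a) := by
  rw [prod_complexZeros hm hi]
  exact (IsAlgClosed.splits _).eq_prod_roots_of_monic (hm.map _)

theorem intMahlerMeasure_eq_prod {P : ℤ[X]} (hm : P.Monic) (hi : Irreducible P) :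
    intMahlerMeasure P = ∏ a ∈ complexZeros P, max 1 ‖a‖ := by
  rw [intMahlerMeasure, mahlerMeasure_eq_leadingCoeff_mul_prod_roots, prod_complexZeros hm hi,
    (hm.map _).leadingCoeff]
  simp

/-- The product of the values of `Q` over the zeros of `P` is the integer `Res(P, Q)`. -/
theorem prod_aeval_eq_resultant {P : ℤ[X]} (hm : P.Monic) (hi : Irreducible P) (Q : ℤ[X]) :
    ∏ a ∈ complexZeros P, aeval a Q = (resultant P Q : ℤ) := by
  have h := resultant_eq_prod_eval (P.map (Int.castRingHom ℂ)) (Q.map (Int.castRingHom ℂ))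
    Q.natDegree natDegree_map_le (IsAlgClosed.splits _)
  rw [hm.natDegree_map, resultant_map_map, (hm.map _).leadingCoeff, one_pow, one_mul] at h
  rw [prod_complexZeros hm hi]
  simp only [eq_intCast] at h
  rw [h]
  congr 1
  refine Multiset.map_congr rfl fun x _ => ?_
  rw [eval_map, aeval_def]
  rfl

theorem eq_minpoly_of_aeval_eq_zero {P : ℤ[X]} (hm : P.Monic) (hi : Irreducible P) {z : ℂ}
    (hz : aeval z P = 0) : P = minpoly ℤ z := by
  have hint : IsIntegral ℤ z := ⟨P, hm, hz⟩
  obtain ⟨R, hR⟩ := minpoly.isIntegrallyClosed_dvd hint hz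
  refine eq_of_monic_of_associated hm (minpoly.monic hint) ?_
  have : IsUnit R := (hi.isUnit_or_isUnit hR).resolve_left (minpoly.not_isUnit ℤ z)
  exact (associated_mul_unit_left _ _ this).symm.trans (by rw [← hR]) |>.symm

theorem dvd_of_aeval_eq_zero {P : ℤ[X]} (hm : P.Monic) (hi : Irreducible P) {z : ℂ}
    (hz : z ∈ complexZeros P) {Q : ℤ[X]} (hQ : aeval z Q = 0) : P ∣ Q := by
  rw [mem_complexZeros hm.ne_zero] at hz
  rw [eq_minpoly_of_aeval_eq_zero hm hi hz]
  exact minpoly.isIntegrallyClosed_dvd ⟨P, hm, hz⟩ hQ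

theorem aeval_eq_zero_of_dvd {P Q : ℤ[X]} (hm : P.Monic) (h : P ∣ Q) {z : ℂ}
    (hz : z ∈ complexZeros P) : aeval z Q = 0 := by
  obtain ⟨R, rfl⟩ := h
  rw [map_mul, (mem_complexZeros hm.ne_zero).1 hz, zero_mul]

theorem prod_norm_aeval_eq_natAbs {P : ℤ[X]} (hm : P.Monic) (hi : Irreducible P) (Q : ℤ[X]) :
    ∏ a ∈ complexZeros P, ‖aeval a Q‖ = ((resultant P Q).natAbs : ℝ) := by
  rw [← norm_prod, prod_aeval_eq_resultant hm hi, Complex.norm_intCast, Nat.cast_natAbs]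
  simp

/-- The product is |Res(P, Q)|, a natural number, and a single vanishing factor already forces `P ∣
Q`. -/
theorem one_le_prod_norm_aeval {P : ℤ[X]} (hm : P.Monic) (hi : Irreducible P) {Q : ℤ[X]}
    (hQ : ¬ P ∣ Q) : 1 ≤ ∏ a ∈ complexZeros P, ‖aeval a Q‖ := by
  have h : 0 < ∏ a ∈ complexZeros P, ‖aeval a Q‖ := by
    refine Finset.prod_pos fun a ha => norm_pos_iff.2 fun h => hQ ?_
    exact dvd_of_aeval_eq_zero hm hi ha h
  rw [prod_norm_aeval_eq_natAbs hm hi] at h ⊢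
  exact_mod_cast h

theorem dvd_of_prod_norm_lt_one {P : ℤ[X]} (hm : P.Monic) (hi : Irreducible P) {Q : ℤ[X]}
    (h : ∏ a ∈ complexZeros P, ‖aeval a Q‖ < 1) : P ∣ Q := by
  by_contra hQ
  exact absurd (one_le_prod_norm_aeval hm hi hQ) (not_le.2 h)

theorem ne_zero_of_mem_complexZeros {P : ℤ[X]} (hm : P.Monic) (hi : Irreducible P)
    (hd : 2 ≤ P.natDegree) {z : ℂ} (hz : z ∈ complexZeros P) : z ≠ 0 := by
  rintro rfl
  refine not_dvd_of_natDegree_lt (p := P) X_ne_zero (by rw [natDegree_X]; omega) ?_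
  exact dvd_of_aeval_eq_zero hm hi hz (by simp)

/-- Conjugation: any two zeros of `P` are exchanged by a self-map of the zeros which preserves
the multiplicative relations between pairs of zeros. -/
theorem exists_conj_map {P : ℤ[X]} (hm : P.Monic) (hi : Irreducible P) {a b : ℂ}
    (ha : a ∈ complexZeros P) (hb : b ∈ complexZeros P) :
    ∃ f : ℂ → ℂ, f a = b ∧ (∀ x ∈ complexZeros P, f x ∈ complexZeros P) ∧
      ∀ x ∈ complexZeros P, ∀ y ∈ complexZeros P, ∀ m n : ℕ,
        f x ^ m = f y ^ n ↔ x ^ m = y ^ n := by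
  classical
  have key : ∀ z ∈ complexZeros P, IsIntegral ℤ z := fun z hz =>
    ⟨P, hm, (mem_complexZeros hm.ne_zero).1 hz⟩
  have mem : ∀ z ∈ complexZeros P, z ∈ algebraicClosure ℚ ℂ := fun z hz =>
    mem_algebraicClosure_iff.2 ((key z hz).tower_top (A := ℚ)).isAlgebraic
  have mp : ∀ z ∈ complexZeros P, minpoly ℚ z = P.map (algebraMap ℤ ℚ) := fun z hz => by
    rw [minpoly.isIntegrallyClosed_eq_field_fractions' ℚ (key z hz),
      ← eq_minpoly_of_aeval_eq_zero hm hi ((mem_complexZeros hm.ne_zero).1 hz)]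
  -- Both zeros have minimal polynomial `P` over ℚ, and the algebraic closure of ℚ in ℂ is normal,
  -- so some automorphism `σ` carries `a` to `b`. The map wanted is `σ`, with default value 0 at
  -- transcendental numbers.
  have hconj : IsConjRoot ℚ (⟨b, mem b hb⟩ : algebraicClosure ℚ ℂ) ⟨a, mem a ha⟩ := by
    rw [IsConjRoot, ← minpoly.algebraMap_eq (algebraMap (algebraicClosure ℚ ℂ) ℂ).injective,
      ← minpoly.algebraMap_eq (algebraMap (algebraicClosure ℚ ℂ) ℂ).injective]
    exact (mp b hb).trans (mp a ha).symm
  have : IsAlgClosure ℚ (algebraicClosure ℚ ℂ) := algebraicClosure.isAlgClosure ℚ ℂ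
  have : Normal ℚ (algebraicClosure ℚ ℂ) := IsAlgClosure.normal ℚ _
  obtain ⟨σ, hσ⟩ := isConjRoot_iff_exists_algEquiv.1 hconj
  have hval : ∀ c (hc : c ∈ complexZeros P),
      (if h : c ∈ algebraicClosure ℚ ℂ then ((σ ⟨c, h⟩ : algebraicClosure ℚ ℂ) : ℂ) else 0) =
        σ ⟨c, mem c hc⟩ := fun c hc => dif_pos (mem c hc)
  refine ⟨fun c => if h : c ∈ algebraicClosure ℚ ℂ then
    ((σ ⟨c, h⟩ : algebraicClosure ℚ ℂ) : ℂ) else 0, ?_, fun c hc => ?_, fun x hx y hy m n => ?_⟩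
  · exact (hval a ha).trans (congrArg Subtype.val hσ)
  swap
  · simp only [hval x hx, hval y hy]
    rw [← SubmonoidClass.coe_pow, ← SubmonoidClass.coe_pow, Subtype.coe_inj, ← map_pow, ← map_pow,
      σ.injective.eq_iff, ← Subtype.coe_inj, SubmonoidClass.coe_pow, SubmonoidClass.coe_pow]
  simp only [hval c hc]
  rw [mem_complexZeros hm.ne_zero]
  have h1 : aeval (⟨c, mem c hc⟩ : algebraicClosure ℚ ℂ) P = 0 := by
    apply (algebraMap (algebraicClosure ℚ ℂ) ℂ).injective
    rw [map_zero, ← aeval_algebraMap_apply]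
    exact (mem_complexZeros hm.ne_zero).1 hc
  have h2 : aeval (σ ⟨c, mem c hc⟩) P = 0 := by
    have := congrArg σ h1
    rw [map_zero] at this
    rw [← this]
    exact aeval_algHom_apply (σ.toAlgHom.restrictScalars ℤ) _ P
  have h3 := aeval_algebraMap_apply ℂ (σ ⟨c, mem c hc⟩) P
  rw [h2, map_zero] at h3
  exact h3

/-! ### A positive proportion of zeros near `c` -/

/-- Compactness, used twice: the far arc gives `q`; then |log|z|| has a positive minimum on the far
points of a closed annulus where |Q| ≥ q, since none of them lies on the unit circle. -/
theorem exists_radius_lt_one {Q : ℤ[X]} {c : ℂ}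
    (hQ : ∀ z : ℂ, ‖z‖ = 1 → 1 ≤ ‖z - c‖ → ‖aeval z Q‖ < 1) :
    ∃ q δ : ℝ, 0 < q ∧ q < 1 ∧ 0 < δ ∧
      ∀ z : ℂ, 1 ≤ ‖z - c‖ → |Real.log ‖z‖| < δ → z ≠ 0 → ‖aeval z Q‖ ≤ q := by
  have hcont : Continuous fun z : ℂ => ‖aeval z Q‖ := by
    have := (Q.continuous_aeval (A := ℂ)); fun_prop
  obtain ⟨q, hq0, hq1, hq⟩ : ∃ q : ℝ, 0 < q ∧ q < 1 ∧
      ∀ z : ℂ, ‖z‖ = 1 → 1 ≤ ‖z - c‖ → ‖aeval z Q‖ < q := by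
    have hK : IsCompact (Metric.sphere (0 : ℂ) 1 ∩ {z : ℂ | 1 ≤ ‖z - c‖}) :=
      (isCompact_sphere 0 1).inter_right (isClosed_le continuous_const (by fun_prop))
    rcases (Metric.sphere (0 : ℂ) 1 ∩ {z : ℂ | 1 ≤ ‖z - c‖}).eq_empty_or_nonempty with h | h
    · refine ⟨1 / 2, by norm_num, by norm_num, fun z h1 h2 => ?_⟩
      exact absurd (h ▸ ⟨by simpa using h1, h2⟩ : z ∈ (∅ : Set ℂ)) (Set.notMem_empty z)
    · obtain ⟨w, hw, hmax⟩ := hK.exists_isMaxOn h hcont.continuousOn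
      have hw1 := hQ w (by simpa using hw.1) hw.2
      refine ⟨(‖aeval w Q‖ + 1) / 2, by positivity, by linarith, fun z h1 h2 => ?_⟩
      have : ‖aeval z Q‖ ≤ ‖aeval w Q‖ := hmax ⟨by simpa using h1, h2⟩
      linarith
  obtain ⟨δ, hδ, hδ'⟩ : ∃ δ : ℝ, 0 < δ ∧ ∀ z : ℂ, ‖z‖ ≤ 3 → 1 / 3 ≤ ‖z‖ → 1 ≤ ‖z - c‖ →
      q ≤ ‖aeval z Q‖ → δ ≤ |Real.log ‖z‖| := by
    set K : Set ℂ := Metric.closedBall 0 3 ∩ ({z | 1 / 3 ≤ ‖z‖} ∩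
      ({z : ℂ | 1 ≤ ‖z - c‖} ∩ {z | q ≤ ‖aeval z Q‖})) with hKdef
    have hK : IsCompact K := (isCompact_closedBall 0 3).inter_right
      ((isClosed_le continuous_const (by fun_prop)).inter
        ((isClosed_le continuous_const (by fun_prop)).inter
          (isClosed_le continuous_const hcont)))
    have hmem : ∀ z : ℂ, ‖z‖ ≤ 3 → 1 / 3 ≤ ‖z‖ → 1 ≤ ‖z - c‖ → q ≤ ‖aeval z Q‖ → z ∈ K :=
      fun z h1 h2 h3 h4 => ⟨by simpa using h1, h2, h3, h4⟩
    rcases K.eq_empty_or_nonempty with h | h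
    · refine ⟨1, one_pos, fun z h1 h2 h3 h4 => ?_⟩
      exact absurd (hmem z h1 h2 h3 h4) (by rw [h]; exact Set.notMem_empty z)
    · have hc : ContinuousOn (fun z : ℂ => |Real.log ‖z‖|) K := by
        refine (ContinuousOn.log (by fun_prop) fun z hz => ?_).abs
        have : (1 : ℝ) / 3 ≤ ‖z‖ := hz.2.1
        positivity
      obtain ⟨w, hw, hmin⟩ := hK.exists_isMinOn h hc
      refine ⟨|Real.log ‖w‖|, abs_pos.2 fun h0 => ?_, fun z h1 h2 h3 h4 =>
        hmin (hmem z h1 h2 h3 h4)⟩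
      have hw3 : (1 : ℝ) / 3 ≤ ‖w‖ := hw.2.1
      rcases Real.log_eq_zero.1 h0 with h | h | h
      · linarith
      · exact absurd (hq w h hw.2.2.1) (not_lt.2 hw.2.2.2)
      · linarith
  -- The bound 1 keeps `z` in the annulus 1/3 ≤ |z| ≤ 3, because e < 3.
  refine ⟨q, min δ 1, hq0, hq1, by positivity, fun z h1 h2 hz => ?_⟩
  by_contra! hcon
  have hz0 : 0 < ‖z‖ := norm_pos_iff.2 hz
  obtain ⟨h3, h4⟩ := abs_lt.1 (h2.trans_le (min_le_right _ _))
  have e3 : Real.exp 1 < 3 := Real.exp_one_lt_three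
  have h5 : ‖z‖ ≤ 3 := ((Real.log_lt_iff_lt_exp hz0).1 h4).le.trans e3.le
  have h6 : 1 / 3 ≤ ‖z‖ := by
    have := (Real.lt_log_iff_exp_lt hz0).1 h3
    rw [Real.exp_neg] at this
    have h7 : (3 : ℝ)⁻¹ ≤ (Real.exp 1)⁻¹ := inv_anti₀ (Real.exp_pos 1) e3.le
    norm_num at h7 ⊢
    linarith
  exact absurd (hδ' z h5 h6 h1 hcon.le) (not_le.2 (h2.trans_le (min_le_left _ _)))

theorem exists_norm_aeval_le (Q : ℤ[X]) :
    ∃ L : ℝ, 1 ≤ L ∧ ∀ z : ℂ, ‖aeval z Q‖ ≤ L * max 1 ‖z‖ ^ Q.natDegree := by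
  refine ⟨1 + ∑ i ∈ Finset.range (Q.natDegree + 1), ‖(Q.coeff i : ℂ)‖,
    le_add_of_nonneg_right (by positivity), fun z => ?_⟩
  rw [aeval_eq_sum_range, add_mul, Finset.sum_mul]
  refine (norm_sum_le _ _).trans ((Finset.sum_le_sum fun i hi => ?_).trans
    (le_add_of_nonneg_left (by positivity)))
  rw [zsmul_eq_mul, norm_mul, norm_pow]
  gcongr
  calc ‖z‖ ^ i ≤ max 1 ‖z‖ ^ i := by gcongr; exact le_max_right _ _
    _ ≤ _ := pow_le_pow_right₀ (le_max_left _ _) (by have := Finset.mem_range.1 hi; omega)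

theorem log_intMahlerMeasure_eq_sum {P : ℤ[X]} (hm : P.Monic) (hi : Irreducible P) :
    Real.log (intMahlerMeasure P) = ∑ a ∈ complexZeros P, Real.log (max 1 ‖a‖) := by
  rw [intMahlerMeasure_eq_prod hm hi, Real.log_prod]
  intro a _
  have : (0 : ℝ) < max 1 ‖a‖ := by positivity
  exact this.ne'

/-- |log t| = 2 log max(1, t) - log t, and the sum of log|a| is log|P(0)| ≥ 0. -/
theorem sum_abs_log_norm_le {P : ℤ[X]} (hm : P.Monic) (hi : Irreducible P)
    (hd : 2 ≤ P.natDegree) :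
    ∑ a ∈ complexZeros P, |Real.log ‖a‖| ≤ 2 * Real.log (intMahlerMeasure P) := by
  have h1 : 0 ≤ ∑ a ∈ complexZeros P, Real.log ‖a‖ := by
    have := one_le_prod_norm_aeval hm hi
      (not_dvd_of_natDegree_lt (p := P) (q := X) X_ne_zero (by rw [natDegree_X]; omega))
    simp only [aeval_X] at this
    rw [← Real.log_prod fun a ha => norm_ne_zero_iff.2 (ne_zero_of_mem_complexZeros hm hi hd ha)]
    exact Real.log_nonneg this
  have h2 : ∀ a ∈ complexZeros P,
      |Real.log ‖a‖| = 2 * Real.log (max 1 ‖a‖) - Real.log ‖a‖ := fun a ha => by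
    have ha0 : 0 < ‖a‖ := norm_pos_iff.2 (ne_zero_of_mem_complexZeros hm hi hd ha)
    rcases le_total 1 ‖a‖ with h | h
    · rw [max_eq_right h, abs_of_nonneg (Real.log_nonneg h)]; ring
    · rw [max_eq_left h, abs_of_nonpos (Real.log_nonpos ha0.le h), Real.log_one]; ring
  rw [Finset.sum_congr rfl h2, Finset.sum_sub_distrib, ← Finset.mul_sum,
    ← log_intMahlerMeasure_eq_sum hm hi]
  linarith

theorem ncard_zerosNear {P : ℤ[X]} (hP : P ≠ 0) (c : ℂ) [DecidablePred fun a : ℂ => ‖a - c‖ < 1] :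
    (zerosNear P c).ncard = ((complexZeros P).filter fun a => ‖a - c‖ < 1).card := by
  rw [← Set.ncard_coe_finset]
  congr 1
  ext z
  simp [zerosNear, mem_complexZeros hP]

/-- If some integer polynomial is smaller than `1` on the part of the unit circle at distance at
least `1` from `c`, then a positive proportion of the zeros of an irreducible polynomial of small
Mahler measure is at distance less than `1` from `c`. -/
theorem exists_linear_zero_count {Q : ℤ[X]} (hQ0 : Q ≠ 0) {c : ℂ}
    (hQ : ∀ z : ℂ, ‖z‖ = 1 → 1 ≤ ‖z - c‖ → ‖aeval z Q‖ < 1) :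
    ∃ κ η : ℝ, 0 < κ ∧ 0 < η ∧ ∃ D : ℕ, ∀ P : ℤ[X], P.Monic → Irreducible P →
      D ≤ P.natDegree → Real.log (intMahlerMeasure P) ≤ η * P.natDegree →
        κ * P.natDegree ≤ (zerosNear P c).ncard := by
  classical
  obtain ⟨q, δ, hq0, hq1, hδ, hq⟩ := exists_radius_lt_one hQ
  obtain ⟨L, hL, hLQ⟩ := exists_norm_aeval_le Q
  have hA : 0 < -Real.log q := neg_pos.2 (Real.log_neg hq0 hq1)
  have hB : 0 ≤ Real.log L := Real.log_nonneg hL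
  set A := -Real.log q with hAdef
  set B := Real.log L + A with hBdef
  have hBpos : 0 < B := by linarith
  set E := B * (2 / δ) + Q.natDegree with hEdef
  have hE : 0 < E := by positivity
  -- Summing the pointwise bound `hpt` gives 0 ≤ -A·d + B·#near + E·log M; this η makes the last
  -- term at most A·d/2.
  refine ⟨A / (2 * B), A / (2 * E), by positivity, by positivity, Q.natDegree + 2,
    fun P hm hi hd hM => ?_⟩
  have hd2 : 2 ≤ P.natDegree := by omega
  have hnd : ¬ P ∣ Q := not_dvd_of_natDegree_lt hQ0 (by omega)
  have hne : ∀ a ∈ complexZeros P, ‖aeval a Q‖ ≠ 0 := fun a ha h =>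
    hnd (dvd_of_aeval_eq_zero hm hi ha (norm_eq_zero.1 h))
  -- Three cases: near `c`, where -A + B = log L; far from `c` with |log|a|| < δ, where |Q(a)| ≤ q;
  -- and |log|a|| ≥ δ, where the third term is at least B.
  have hpt : ∀ a ∈ complexZeros P, Real.log ‖aeval a Q‖ ≤
      -A + B * (if ‖a - c‖ < 1 then 1 else 0) + B * (|Real.log ‖a‖| / δ) +
        Q.natDegree * Real.log (max 1 ‖a‖) := fun a ha => by
    have h1 : 0 ≤ Real.log (max 1 ‖a‖) := Real.log_nonneg (le_max_left _ _)
    have h2 : 0 ≤ |Real.log ‖a‖| / δ := by positivity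
    have h3 : Real.log ‖aeval a Q‖ ≤ Real.log L + Q.natDegree * Real.log (max 1 ‖a‖) := by
      have h4 : (0 : ℝ) < max 1 ‖a‖ := by positivity
      rw [← Real.log_pow, ← Real.log_mul (by positivity) (by positivity)]
      exact Real.log_le_log ((norm_nonneg _).lt_of_ne' (hne a ha)) (hLQ a)
    have h5 : 0 ≤ B * (|Real.log ‖a‖| / δ) := by positivity
    have h6 : 0 ≤ Q.natDegree * Real.log (max 1 ‖a‖) := by positivity
    split_ifs with hnear
    · linarith
    · rcases lt_or_ge |Real.log ‖a‖| δ with h7 | h7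
      · have := Real.log_le_log ((norm_nonneg _).lt_of_ne' (hne a ha))
          (hq a (not_lt.1 hnear) h7 (ne_zero_of_mem_complexZeros hm hi hd2 ha))
        linarith
      · have : B * 1 ≤ B * (|Real.log ‖a‖| / δ) := by
          gcongr; rwa [le_div_iff₀ hδ, one_mul]
        linarith
  have h0 : 0 ≤ ∑ a ∈ complexZeros P, Real.log ‖aeval a Q‖ := by
    rw [← Real.log_prod hne]
    exact Real.log_nonneg (one_le_prod_norm_aeval hm hi hnd)
  have h1 := h0.trans (Finset.sum_le_sum hpt)
  rw [Finset.sum_add_distrib, Finset.sum_add_distrib, Finset.sum_add_distrib, ← Finset.mul_sum,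
    ← Finset.mul_sum, ← Finset.mul_sum, ← Finset.sum_div, Finset.sum_boole,
    ← log_intMahlerMeasure_eq_sum hm hi, Finset.sum_const, card_complexZeros hm hi,
    nsmul_eq_mul, ← ncard_zerosNear hm.ne_zero c] at h1
  have h2 : B * ((∑ a ∈ complexZeros P, |Real.log ‖a‖|) / δ) ≤
      B * (2 / δ) * Real.log (intMahlerMeasure P) := by
    rw [mul_assoc, div_mul_eq_mul_div]
    gcongr
    exact sum_abs_log_norm_le hm hi hd2
  have h3 : E * Real.log (intMahlerMeasure P) ≤ A / 2 * P.natDegree := by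
    calc E * Real.log (intMahlerMeasure P) ≤ E * (A / (2 * E) * P.natDegree) := by gcongr
      _ = A / 2 * P.natDegree := by field_simp
  have h4 : A / 2 * P.natDegree ≤ B * (zerosNear P c).ncard := by
    rw [hEdef, add_mul] at h3
    linarith
  calc A / (2 * B) * P.natDegree = A / 2 * P.natDegree / B := by field_simp
    _ ≤ _ := by rwa [div_le_iff₀' hBpos]

/-! ### The auxiliary polynomial -/

/-- A product of cyclotomic polynomials which is small on the unit circle away from `1`. -/
noncomputable def smallAwayFromOne : ℤ[X] :=
  (X ^ 2 + 1) * (X ^ 2 + X + 1) * (X ^ 4 + X ^ 3 + X ^ 2 + X + 1) * (X ^ 2 - X + 1) * (X + 1) ^ 2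

/-- With v = u² + u ∈ [-1/4, 2] the product becomes the cubic v(v - 1)(v - 2). -/
theorem abs_golden_product_lt_one {u : ℝ} (h1 : -2 ≤ u) (h2 : u ≤ 1) :
    |u * (u + 1) * (u ^ 2 + u - 1) * ((u - 1) * (u + 2))| < 1 := by
  have e : u * (u + 1) * (u ^ 2 + u - 1) * ((u - 1) * (u + 2)) =
    (u ^ 2 + u) * ((u ^ 2 + u) - 1) * ((u ^ 2 + u) - 2) := by ring
  have h3 : -(1 / 4) ≤ u ^ 2 + u := by nlinarith [sq_nonneg (u + 1 / 2)]
  have h4 : u ^ 2 + u ≤ 2 := by nlinarith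
  rw [e]
  generalize u ^ 2 + u = v at *
  rw [abs_lt]
  constructor
  · nlinarith [mul_nonneg (sub_nonneg.2 h4) (sq_nonneg (v - 1 / 4)), sq_nonneg (v - 1 / 2),
      mul_nonneg (sub_nonneg.2 h4) (sub_nonneg.2 h3), sq_nonneg v]
  · nlinarith [mul_nonneg (sub_nonneg.2 h4) (sq_nonneg (v - 1 / 2)), sq_nonneg (v - 1 / 2),
      mul_nonneg (sub_nonneg.2 h4) (sub_nonneg.2 h3), sq_nonneg v]

theorem norm_smallAwayFromOne_lt {z : ℂ} (hz : ‖z‖ = 1) (h : 1 ≤ ‖z - 1‖) :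
    ‖aeval z smallAwayFromOne‖ < 1 := by
  have hzz : z * (starRingEnd ℂ) z = 1 := by rw [Complex.mul_conj, Complex.normSq_eq_norm_sq, hz]; simp
  have hu : z + (starRingEnd ℂ) z = ((2 * z.re : ℝ) : ℂ) := Complex.add_conj z
  have hre : z.re ^ 2 + z.im ^ 2 = 1 := by
    have := Complex.normSq_eq_norm_sq z
    rw [hz, Complex.normSq_apply] at this
    linarith
  have h2 : 2 * z.re ≤ 1 := by
    have h3 := Complex.normSq_eq_norm_sq (z - 1)
    rw [Complex.normSq_apply] at h3
    simp only [Complex.sub_re, Complex.one_re, Complex.sub_im, Complex.one_im, sub_zero] at h3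
    nlinarith
  have h1 : -2 ≤ 2 * z.re := by nlinarith [sq_nonneg z.im, sq_nonneg (z.re + 1)]
  -- Each of the factors is self-reciprocal (with (x + 1)² taken as one), hence a power of z times a
  -- polynomial in u = z + 1/z = 2 Re z; |z - 1| ≥ 1 means u ≤ 1.
  have e : aeval z smallAwayFromOne = z ^ 6 *
      ((2 * z.re * (2 * z.re + 1) * ((2 * z.re) ^ 2 + 2 * z.re - 1) *
        ((2 * z.re - 1) * (2 * z.re + 2)) : ℝ) : ℂ) := by
    have hu' : (z : ℂ) * ((2 * z.re : ℝ) : ℂ) = z ^ 2 + 1 := by rw [← hu]; linear_combination hzz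
    generalize (2 * z.re : ℝ) = u at *
    have e1 : z * ((u : ℂ) + 1) = z ^ 2 + z + 1 := by linear_combination hu'
    have e2 : z ^ 2 * ((u : ℂ) ^ 2 + u - 1) = z ^ 4 + z ^ 3 + z ^ 2 + z + 1 := by
      linear_combination (z * u + z ^ 2 + z + 1) * hu'
    have e3 : z * ((u : ℂ) - 1) = z ^ 2 - z + 1 := by linear_combination hu'
    have e4 : z * ((u : ℂ) + 2) = (z + 1) ^ 2 := by linear_combination hu'
    simp only [smallAwayFromOne, map_mul, map_add, map_sub, map_pow, aeval_X, map_one]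
    rw [← hu', ← e1, ← e2, ← e3, ← e4]
    push_cast
    ring
  rw [e, norm_mul, norm_pow, hz, one_pow, one_mul, Complex.norm_real, Real.norm_eq_abs]
  exact abs_golden_product_lt_one h1 h2

theorem monic_smallAwayFromOne : smallAwayFromOne.Monic := by
  unfold smallAwayFromOne
  monicity!

theorem norm_smallAwayFromOne_neg_lt {z : ℂ} (hz : ‖z‖ = 1) (h : 1 ≤ ‖z - (-1)‖) :
    ‖aeval z (smallAwayFromOne.comp (-X))‖ < 1 := by
  rw [aeval_comp, map_neg, aeval_X]
  refine norm_smallAwayFromOne_lt (by rwa [norm_neg]) ?_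
  rwa [← norm_neg, neg_sub, sub_neg_eq_add, add_comm, ← sub_neg_eq_add]

theorem smallAwayFromOne_comp_neg_ne_zero : smallAwayFromOne.comp (-X) ≠ 0 := by
  intro h
  have h2 := congrArg (fun p : ℤ[X] => p.comp (-X)) h
  simp only [comp_assoc, neg_comp, X_comp, neg_neg, comp_X, zero_comp] at h2
  exact monic_smallAwayFromOne.ne_zero h2

/-! ### Ingredients of Dobrowolski's argument -/

/-- The Frobenius identity P(x^p) = P(x)^p in characteristic p. -/
theorem exists_expand_eq (P : ℤ[X]) {p : ℕ} (hp : p.Prime) :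
    ∃ R : ℤ[X], expand ℤ p P = P ^ p + C (p : ℤ) * R := by
  have : Fact p.Prime := ⟨hp⟩
  have h : C (p : ℤ) ∣ expand ℤ p P - P ^ p := by
    rw [C_dvd_iff_dvd_coeff]
    intro i
    rw [← ZMod.intCast_zmod_eq_zero_iff_dvd]
    have h2 : (expand ℤ p P - P ^ p).map (Int.castRingHom (ZMod p)) = 0 := by
      rw [Polynomial.map_sub, map_expand, ZMod.expand_card, Polynomial.map_pow, sub_self]
    have := congrArg (fun f => f.coeff i) h2
    rw [coeff_map, coeff_zero] at this
    exact this
  obtain ⟨R, hR⟩ := h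
  exact ⟨R, by rw [← hR]; ring⟩

/-- If `P ^ k` divides `F`, the norm of `F (a ^ p)` is divisible by `p ^ (k * deg P)`. -/
theorem pow_le_prod_norm_aeval_pow {P F : ℤ[X]} (hm : P.Monic) (hi : Irreducible P) {k p : ℕ}
    (hp : p.Prime) (hF : P ^ k ∣ F) (h : ¬ P ∣ expand ℤ p F) :
    (p : ℝ) ^ (k * P.natDegree) ≤ ∏ a ∈ complexZeros P, ‖aeval (a ^ p) F‖ := by
  obtain ⟨G, rfl⟩ := hF
  obtain ⟨R, hR⟩ := exists_expand_eq P hp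
  have hG : ¬ P ∣ expand ℤ p G := fun hd => h (by rw [map_mul]; exact hd.mul_left _)
  have hone : ∀ x ∈ complexZeros P, aeval (x ^ p) P = p * aeval x R := fun x hx => by
    rw [← expand_aeval, hR, map_add, map_pow, (mem_complexZeros hm.ne_zero).1 hx,
      zero_pow hp.ne_zero, zero_add, map_mul, aeval_C]
    simp
  -- Each of the k factors P(a^p) = p·R(a) contributes a p; the remaining products are norms of
  -- nonzero algebraic integers.
  have hprod : ∏ a ∈ complexZeros P, ‖aeval (a ^ p) (P ^ k * G)‖ =
      (p : ℝ) ^ (k * P.natDegree) * ((∏ a ∈ complexZeros P, ‖aeval a R‖) ^ k *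
        ∏ a ∈ complexZeros P, ‖aeval a (expand ℤ p G)‖) := by
    rw [← Finset.prod_pow, ← Finset.prod_mul_distrib, mul_comm k, pow_mul,
      ← card_complexZeros hm hi, ← Finset.prod_const, ← Finset.prod_pow,
      ← Finset.prod_mul_distrib]
    refine Finset.prod_congr rfl fun a ha => ?_
    rw [map_mul, map_pow, hone a ha, expand_aeval, norm_mul, norm_pow, norm_mul,
      Complex.norm_natCast, mul_pow, mul_assoc]
  rw [hprod]
  refine le_mul_of_one_le_right (by positivity) (one_le_mul_of_one_le_of_one_le ?_
    (one_le_prod_norm_aeval hm hi hG))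
  rcases Nat.eq_zero_or_pos k with rfl | hk
  · simp
  refine one_le_pow₀ (one_le_prod_norm_aeval hm hi fun hd => h ?_)
  rw [map_mul, map_pow, hR]
  exact (dvd_pow (dvd_add (dvd_pow_self _ hp.ne_zero) (hd.mul_left _)) hk.ne').mul_right _

theorem norm_aeval_le_of_coeff_le {F : ℤ[X]} {N : ℕ} {B : ℝ} (hF : F.degree < N)
    (hc : ∀ n, |(F.coeff n : ℝ)| ≤ B) (z : ℂ) :
    ‖aeval z F‖ ≤ N * B * max 1 ‖z‖ ^ N := by
  have hB : 0 ≤ B := (abs_nonneg _).trans (hc 0)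
  rcases eq_or_ne F 0 with rfl | hF0
  · rw [map_zero, norm_zero]; positivity
  have hlt : F.natDegree < N := (natDegree_lt_iff_degree_lt hF0).2 hF
  rw [aeval_eq_sum_range' hlt, mul_assoc, ← nsmul_eq_mul]
  refine (norm_sum_le _ _).trans ?_
  refine (Finset.sum_le_card_nsmul _ _ (B * max 1 ‖z‖ ^ N) fun i hi => ?_).trans_eq
    (by rw [Finset.card_range])
  rw [zsmul_eq_mul, norm_mul, norm_pow, Complex.norm_intCast]
  gcongr
  · exact hc i
  · calc ‖z‖ ^ i ≤ max 1 ‖z‖ ^ i := by gcongr; exact le_max_right _ _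
      _ ≤ _ := pow_le_pow_right₀ (le_max_left _ _) (Finset.mem_range.1 hi).le

theorem abs_coeff_iterate_derivative_le {F : ℤ[X]} {N : ℕ} {B : ℝ} (hF : F.degree < N)
    (hc : ∀ n, |(F.coeff n : ℝ)| ≤ B) (j : ℕ) :
    (derivative^[j] F).degree < N ∧ ∀ n, |((derivative^[j] F).coeff n : ℝ)| ≤ N ^ j * B := by
  induction j with
  | zero => simpa using ⟨hF, hc⟩
  | succ j ih =>
    rw [Function.iterate_succ_apply']
    have hB : 0 ≤ B := (abs_nonneg _).trans (hc 0)
    refine ⟨(degree_derivative_le).trans_lt ih.1, fun n => ?_⟩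
    rw [coeff_derivative]
    rcases lt_or_ge (n + 1) N with h | h
    · push_cast
      rw [abs_mul, pow_succ, mul_right_comm]
      gcongr
      · exact ih.2 _
      · rw [abs_of_nonneg (by positivity)]
        exact_mod_cast h.le
    · rw [coeff_eq_zero_of_degree_lt (ih.1.trans_le (by exact_mod_cast h))]
      simp only [zero_mul, Int.cast_zero, abs_zero]
      positivity

/-- Over ℂ every zero of `P` has multiplicity at least `k` in `F`, and the zeros of `P` are simple;
divisibility descends to ℤ because `P ^ k` is monic. -/
theorem pow_dvd_of_forall_dvd_iterate_derivative {P F : ℤ[X]} (hm : P.Monic)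
    (hi : Irreducible P) {k : ℕ} (h : ∀ j < k, P ∣ derivative^[j] F) : P ^ k ∣ F := by
  rcases eq_or_ne F 0 with rfl | hF
  · exact dvd_zero _
  rcases Nat.eq_zero_or_pos k with rfl | hk
  · simp
  have hinj : Function.Injective (Int.castRingHom ℂ) := Int.cast_injective
  have hF' : F.map (Int.castRingHom ℂ) ≠ 0 := (Polynomial.map_ne_zero_iff hinj).2 hF
  rw [← map_dvd_map (Int.castRingHom ℂ) hinj (hm.pow k), Polynomial.map_pow,
    map_eq_prod_complexZeros hm hi, ← Finset.prod_pow]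
  refine Finset.prod_dvd_of_coprime (fun a _ b _ hab => ?_) fun a ha => ?_
  · exact (isCoprime_X_sub_C_of_isUnit_sub (sub_ne_zero.2 hab).isUnit).pow
  · have hlt : k - 1 < rootMultiplicity a (F.map (Int.castRingHom ℂ)) := by
      rw [lt_rootMultiplicity_iff_isRoot_iterate_derivative hF']
      intro j hj
      rw [iterate_derivative_map, IsRoot.def, eval_map]
      exact aeval_eq_zero_of_dvd hm (h j (by omega)) ha
    exact (pow_dvd_pow _ (by omega)).trans (pow_rootMultiplicity_dvd _ a)

theorem card_Icc_neg_ceil_le {x : ℝ} (hx : 2 ≤ x) :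
    ((Finset.Icc (-⌈x⌉) ⌈x⌉).card : ℝ) ≤ 4 * x := by
  have h1 : (0 : ℤ) ≤ ⌈x⌉ := Int.ceil_nonneg (by linarith)
  have h2 : ((Finset.Icc (-⌈x⌉) ⌈x⌉).card : ℤ) = 2 * ⌈x⌉ + 1 := by
    rw [Int.card_Icc, Int.toNat_of_nonneg (by linarith)]; ring
  have h3 : ((Finset.Icc (-⌈x⌉) ⌈x⌉).card : ℝ) = 2 * ⌈x⌉ + 1 := by exact_mod_cast h2
  linarith [Int.ceil_lt_add_one x]

theorem floor_mem_Icc_neg_ceil {x y : ℝ} (h : |y| ≤ x) : ⌊y⌋ ∈ Finset.Icc (-⌈x⌉) ⌈x⌉ := by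
  obtain ⟨h1, h2⟩ := abs_le.1 h
  rw [Finset.mem_Icc]
  refine ⟨?_, ?_⟩
  · rw [Int.le_floor]; push_cast; linarith [Int.le_ceil x]
  · exact (Int.floor_le_ceil y).trans (Int.ceil_le_ceil h2)

theorem norm_sub_lt_one_of_floor_eq {w z : ℂ} (h1 : ⌊2 * w.re⌋ = ⌊2 * z.re⌋)
    (h2 : ⌊2 * w.im⌋ = ⌊2 * z.im⌋) : ‖w - z‖ < 1 := by
  have h3 := Int.abs_sub_lt_one_of_floor_eq_floor h1
  have h4 := Int.abs_sub_lt_one_of_floor_eq_floor h2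
  have h5 := Complex.norm_le_abs_re_add_abs_im (w - z)
  rw [Complex.sub_re, Complex.sub_im] at h5
  rw [← mul_sub, abs_mul, abs_two] at h3 h4
  linarith

theorem coeff_sum_X_pow (S : Finset ℕ) (n : ℕ) :
    (∑ i ∈ S, (X : ℤ[X]) ^ i).coeff n = if n ∈ S then 1 else 0 := by
  simp [coeff_X_pow]

/-- Pigeonhole construction of a polynomial with small coefficients divisible by a power of
`P`. -/
theorem exists_pow_dvd_of_small_coeff {P : ℤ[X]} (hm : P.Monic) (hi : Irreducible P) {k N : ℕ} (hN : 0 < N)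
    (hcard : ((8 * (N : ℝ) ^ k) ^ (2 * k)) ^ P.natDegree * intMahlerMeasure P ^ (2 * k * N) <
      2 ^ N) :
    ∃ F : ℤ[X], F ≠ 0 ∧ F.degree < N ∧ (∀ n, |(F.coeff n : ℝ)| ≤ 1) ∧ P ^ k ∣ F := by
  classical
  have hN1 : (1 : ℝ) ≤ N := by exact_mod_cast hN
  -- Twice a bound for the derivatives of order j < k at `a`: N coefficients of size at most N^j
  -- give N^(j+1) ≤ N^k.
  set x : ℂ → ℝ := fun a => 2 * ((N : ℝ) ^ k * max 1 ‖a‖ ^ N) with hx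
  have hx2 : ∀ a, 2 ≤ x a := fun a => by
    have : 1 ≤ (N : ℝ) ^ k * max 1 ‖a‖ ^ N :=
      one_le_mul_of_one_le_of_one_le (one_le_pow₀ hN1) (one_le_pow₀ (le_max_left _ _))
    simp only [hx]; linarith
  set g : Finset ℕ → ℤ[X] := fun S => ∑ i ∈ S, X ^ i with hg
  have hcg : ∀ S n, |((g S).coeff n : ℝ)| ≤ 1 := fun S n => by
    simp only [hg, coeff_sum_X_pow]; split_ifs <;> simp
  have hdg : ∀ S ∈ (Finset.range N).powerset, (g S).degree < N := fun S hS => by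
    rw [degree_lt_iff_coeff_zero]
    intro n hn
    have : n ∉ S := fun h =>
      absurd (Finset.mem_range.1 (Finset.mem_powerset.1 hS h)) (not_lt.2 (by exact_mod_cast hn))
    simp only [hg, coeff_sum_X_pow, if_neg this]
  let v : Finset ℕ → complexZeros P × Fin k → ℂ := fun S i =>
    aeval (i.1 : ℂ) (derivative^[(i.2 : ℕ)] (g S))
  let t : Finset (complexZeros P × Fin k → ℤ × ℤ) := Fintype.piFinset fun i =>
    Finset.Icc (-⌈x i.1⌉) ⌈x i.1⌉ ×ˢ Finset.Icc (-⌈x i.1⌉) ⌈x i.1⌉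
  have hv : ∀ S ∈ (Finset.range N).powerset, ∀ i, 2 * ‖v S i‖ ≤ x i.1 := fun S hS i => by
    obtain ⟨h1, h2⟩ := abs_coeff_iterate_derivative_le (hdg S hS) (hcg S) i.2
    have h3 := norm_aeval_le_of_coeff_le h1 h2 (i.1 : ℂ)
    simp only [hx]
    refine mul_le_mul_of_nonneg_left (h3.trans ?_) zero_le_two
    rw [mul_one, ← pow_succ']
    gcongr
    exact i.2.2
  have hmaps : Set.MapsTo (fun S i => (⌊2 * (v S i).re⌋, ⌊2 * (v S i).im⌋))
      ((Finset.range N).powerset : Set (Finset ℕ)) (t : Set _) := fun S hS => by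
    simp only [t, Finset.mem_coe, Fintype.mem_piFinset, Finset.mem_product]
    intro i
    have h := hv S hS i
    constructor <;> refine floor_mem_Icc_neg_ceil (le_trans ?_ h)
    · rw [abs_mul, abs_two]; gcongr; exact Complex.abs_re_le_norm _
    · rw [abs_mul, abs_two]; gcongr; exact Complex.abs_im_le_norm _
  have ht : t.card < (Finset.range N).powerset.card := by
    rw [Finset.card_powerset, Finset.card_range]
    suffices (t.card : ℝ) < 2 ^ N by exact_mod_cast this
    refine lt_of_le_of_lt ?_ hcard
    rw [Fintype.card_piFinset, Fintype.prod_prod_type]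
    push_cast
    simp only [Finset.card_product, Nat.cast_mul, Finset.prod_const, Finset.card_univ,
      Fintype.card_fin]
    rw [Finset.prod_coe_sort (complexZeros P) (fun a =>
      (((Finset.Icc (-⌈x a⌉) ⌈x a⌉).card : ℝ) * ((Finset.Icc (-⌈x a⌉) ⌈x a⌉).card : ℝ)) ^ k),
      intMahlerMeasure_eq_prod hm hi, ← card_complexZeros hm hi, ← Finset.prod_const,
      ← Finset.prod_pow, ← Finset.prod_mul_distrib]
    refine Finset.prod_le_prod (fun _ _ => by positivity) fun a _ => ?_
    calc _ ≤ ((4 * x a) * (4 * x a)) ^ k := by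
          have := card_Icc_neg_ceil_le (hx2 a)
          gcongr
      _ = _ := by
          simp only [hx]
          rw [← sq, show 2 * k * N = N * (2 * k) by ring,
            pow_mul (max 1 ‖a‖) N (2 * k), ← mul_pow]
          rw [pow_mul _ 2 k]
          ring
  -- Two of the 2^N polynomials with coefficients 0 and 1 have all their derivative values in the
  -- same cells of side 1/2.
  obtain ⟨S, hS, T, hT, hne, heq⟩ := Finset.exists_ne_map_eq_of_card_lt_of_maps_to ht hmaps
  refine ⟨g S - g T, fun h => hne ?_, (degree_sub_le _ _).trans_lt (max_lt (hdg S hS) (hdg T hT)),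
    fun n => ?_, pow_dvd_of_forall_dvd_iterate_derivative hm hi fun j hj => ?_⟩
  · ext n
    have := congrArg (fun f => f.coeff n) (sub_eq_zero.1 h)
    simp only [hg, coeff_sum_X_pow] at this
    by_cases h1 : n ∈ S <;> by_cases h2 : n ∈ T <;> simp_all
  · simp only [hg, coeff_sub, coeff_sum_X_pow]
    split_ifs <;> simp
  -- The difference has derivative values of norm below 1 at every zero, so its resultant with `P`
  -- vanishes.
  · refine dvd_of_prod_norm_lt_one hm hi ?_
    have hlt : ∀ a ∈ complexZeros P, ‖aeval a (derivative^[j] (g S - g T))‖ < 1 := fun a ha => by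
      have h := congrFun heq (⟨a, ha⟩, ⟨j, hj⟩)
      rw [Prod.mk.injEq] at h
      rw [iterate_derivative_sub, map_sub]
      exact norm_sub_lt_one_of_floor_eq h.1 h.2
    have hne : (complexZeros P).Nonempty := by
      rw [← Finset.card_pos, card_complexZeros hm hi, Nat.pos_iff_ne_zero]
      intro h0
      exact hi.not_isUnit (by rw [hm.natDegree_eq_zero.1 h0]; exact isUnit_one)
    obtain ⟨b, hb⟩ := hne
    rw [← Finset.mul_prod_erase _ _ hb]
    refine mul_lt_one_of_nonneg_of_lt_one_left (norm_nonneg _) (hlt b hb) ?_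
    exact Finset.prod_le_one (fun _ _ => norm_nonneg _)
      fun a ha => (hlt a (Finset.mem_of_mem_erase ha)).le

theorem exists_one_lt_norm {P : ℤ[X]} (hm : P.Monic) (hi : Irreducible P)
    (h : 0 < Real.log (intMahlerMeasure P)) : ∃ a ∈ complexZeros P, 1 < ‖a‖ := by
  by_contra! hcon
  rw [log_intMahlerMeasure_eq_sum hm hi, Finset.sum_eq_zero] at h
  · exact lt_irrefl _ h
  · intro a ha
    rw [max_eq_left (hcon a ha), Real.log_one]

/-- Different positive powers of zeros of `P` are different if `P` has a zero outside the closed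
unit disc. -/
theorem pow_ne_pow_of_lt {P : ℤ[X]} (hm : P.Monic) (hi : Irreducible P)
    (h : ∃ a ∈ complexZeros P, 1 < ‖a‖) {m n : ℕ} (hmn : m < n) {a b : ℂ}
    (ha : a ∈ complexZeros P) (hb : b ∈ complexZeros P) : a ^ m ≠ b ^ n := by
  intro hab
  obtain ⟨c, hc, hc1⟩ := h
  obtain ⟨w, hw, hmax⟩ := (complexZeros P).exists_max_image (fun z => ‖z‖) ⟨c, hc⟩
  have hw1 : 1 < ‖w‖ := hc1.trans_le (hmax c hc)
  -- Conjugate `b` to a zero `w` of maximal modulus: then |f a|^m = |w|^n > |w|^m is impossible.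
  obtain ⟨f, hf, hfm, hfp⟩ := exists_conj_map hm hi hb hw
  have h1 := (hfp a ha b hb m n).2 hab
  rw [hf] at h1
  have h2 : ‖f a‖ ^ m = ‖w‖ ^ n := by rw [← norm_pow, h1, norm_pow]
  have h3 : ‖f a‖ ^ m ≤ ‖w‖ ^ m := by gcongr; exact hmax _ (hfm a ha)
  exact absurd (pow_lt_pow_right₀ hw1 hmn) (not_lt.2 (h2 ▸ h3))

/-- There are few primes `p` for which the `p`-th powers of the zeros of `P` are not distinct. -/
theorem two_pow_card_le {P : ℤ[X]} (hm : P.Monic) (hi : Irreducible P) (hd : 2 ≤ P.natDegree)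
    {T : Finset ℕ} (hT : ∀ p ∈ T, p.Prime ∧
      ∃ a ∈ complexZeros P, ∃ b ∈ complexZeros P, a ≠ b ∧ a ^ p = b ^ p) :
    2 ^ T.card ≤ P.natDegree := by
  classical
  have hne : ∀ z ∈ complexZeros P, z ≠ 0 := fun z => ne_zero_of_mem_complexZeros hm hi hd
  have key : ∀ p ∈ T, ∀ a ∈ complexZeros P, ∃ b ∈ complexZeros P, orderOf (a / b) = p := by
    intro p hp a ha
    obtain ⟨hpp, x, hx, y, hy, hxy, hpow⟩ := hT p hp
    obtain ⟨f, hf, hfm, hfp⟩ := exists_conj_map hm hi hx ha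
    refine ⟨f y, hfm y hy, ?_⟩
    have : Fact p.Prime := ⟨hpp⟩
    have hy0 := hne _ (hfm y hy)
    refine orderOf_eq_prime ?_ ?_
    · rw [div_pow, ← hf, (hfp x hx y hy p p).2 hpow, div_self (pow_ne_zero _ hy0)]
    · rw [Ne, div_eq_one_iff_eq hy0]
      intro h
      have := (hfp x hx y hy 1 1).1 (by rw [pow_one, pow_one, hf, h])
      rw [pow_one, pow_one] at this
      exact hxy this
  -- Chaining conjugates of the ratios makes the coprime orders multiply, so each subset `S` of `T`
  -- yields its own zero.
  have main : ∀ S ⊆ T, ∀ a ∈ complexZeros P, ∃ b ∈ complexZeros P,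
      orderOf (a / b) = ∏ p ∈ S, p := by
    intro S
    induction S using Finset.induction_on with
    | empty => exact fun _ a ha => ⟨a, ha, by simp [div_self (hne a ha)]⟩
    | insert p S hpS ih =>
      intro hS a ha
      obtain ⟨b, hb, hab⟩ := ih ((Finset.subset_insert _ _).trans hS) a ha
      have hpT := hS (Finset.mem_insert_self _ _)
      obtain ⟨c, hc, hbc⟩ := key p hpT b hb
      refine ⟨c, hc, ?_⟩
      have e : a / c = b / c * (a / b) := by
        have := hne b hb; have := hne c hc; field_simp
      rw [Finset.prod_insert hpS, ← hab, ← hbc, e]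
      refine (Commute.all _ _).orderOf_mul_eq_mul_orderOf_of_coprime ?_
      rw [hab, hbc]
      refine Nat.Coprime.prod_right fun q hq => ?_
      refine (Nat.coprime_primes (hT p hpT).1 (hT q (hS (Finset.mem_insert_of_mem hq))).1).2 ?_
      rintro rfl
      exact hpS hq
  obtain ⟨a, ha⟩ : (complexZeros P).Nonempty := by
    rw [← Finset.card_pos, card_complexZeros hm hi]; omega
  choose! g hg hgo using fun S hS => main S hS a ha
  rw [← Finset.card_powerset, ← card_complexZeros hm hi]
  refine Finset.card_le_card_of_injOn g (fun S hS => hg S (Finset.mem_powerset.1 hS))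
    fun S hS S' hS' h => ?_
  have hS1 := Finset.mem_powerset.1 hS
  have hS2 := Finset.mem_powerset.1 hS'
  rw [← Nat.primeFactors_prod fun p hp => (hT p (hS1 hp)).1,
    ← Nat.primeFactors_prod fun p hp => (hT p (hS2 hp)).1, ← hgo S hS1, ← hgo S' hS2, h]

/-- A polynomial of small degree cannot vanish at the `p`-th powers of the zeros of `P` for all
primes `p` in a large set. -/
theorem exists_not_dvd_expand {P F : ℤ[X]} (hm : P.Monic) (hi : Irreducible P)
    (hd : 2 ≤ P.natDegree) (h : ∃ a ∈ complexZeros P, 1 < ‖a‖) {T : Finset ℕ}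
    (hT : ∀ p ∈ T, p.Prime) {b m : ℕ} (hb : P.natDegree < 2 ^ b) (hTc : m + b ≤ T.card)
    (hF0 : F ≠ 0) (hF : F.degree < (P.natDegree * m : ℕ)) :
    ∃ p ∈ T, ¬ P ∣ expand ℤ p F := by
  classical
  by_contra! hcon
  -- Fewer than `b` primes are bad. For the others the powers a^p are d·m or more distinct zeros of
  -- `F`, too many for its degree.
  set U := T.filter fun p => ∃ a ∈ complexZeros P, ∃ b ∈ complexZeros P, a ≠ b ∧ a ^ p = b ^ p
    with hU
  have hUc : U.card < b := by
    have h1 := two_pow_card_le hm hi hd (T := U) fun p hp =>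
      ⟨hT p (Finset.mem_filter.1 hp).1, (Finset.mem_filter.1 hp).2⟩
    exact (Nat.pow_lt_pow_iff_right (by norm_num)).1 (h1.trans_lt hb)
  have hG : m ≤ (T \ U).card := by
    have := Finset.le_card_sdiff U T
    omega
  have hFC : F.map (Int.castRingHom ℂ) ≠ 0 :=
    (Polynomial.map_ne_zero_iff Int.cast_injective).2 hF0
  have hcard : (complexZeros P ×ˢ (T \ U)).card ≤ (F.map (Int.castRingHom ℂ)).roots.toFinset.card := by
    refine Finset.card_le_card_of_injOn (fun x => x.1 ^ x.2) (fun x hx => ?_) ?_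
    · obtain ⟨hx1, hx2⟩ := Finset.mem_product.1 (Finset.mem_coe.1 hx)
      have := aeval_eq_zero_of_dvd hm (hcon _ (Finset.mem_sdiff.1 hx2).1) hx1
      rw [expand_aeval] at this
      exact (mem_complexZeros hF0).2 this
    · rintro ⟨x, p⟩ hx ⟨y, q⟩ hy hxy
      obtain ⟨hx1, hx2⟩ := Finset.mem_product.1 (Finset.mem_coe.1 hx)
      obtain ⟨hy1, hy2⟩ := Finset.mem_product.1 (Finset.mem_coe.1 hy)
      simp only at hx1 hx2 hy1 hy2 hxy
      rcases lt_trichotomy p q with hlt | rfl | hlt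
      · exact absurd hxy (pow_ne_pow_of_lt hm hi h hlt hx1 hy1)
      · by_cases hne : x = y
        · rw [hne]
        · exact absurd (Finset.mem_filter.2 ⟨(Finset.mem_sdiff.1 hx2).1, x, hx1, y, hy1, hne, hxy⟩)
            (Finset.mem_sdiff.1 hx2).2
      · exact absurd hxy.symm (pow_ne_pow_of_lt hm hi h hlt hy1 hx1)
  rw [Finset.card_product, card_complexZeros hm hi] at hcard
  have h1 := (Multiset.toFinset_card_le _).trans (card_roots' (F.map (Int.castRingHom ℂ)))
  have h2 : (F.map (Int.castRingHom ℂ)).natDegree ≤ F.natDegree := natDegree_map_le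
  have h3 := (natDegree_lt_iff_degree_lt hF0).2 hF
  have h4 : P.natDegree * m ≤ P.natDegree * (T \ U).card := Nat.mul_le_mul_left _ hG
  omega

/-! ### Choice of parameters and the lower bound for the Mahler measure -/

theorem eventually_three_mul_le_primeCounting_sq :
    ∀ᶠ m : ℕ in Filter.atTop, 3 * m ≤ (m ^ 2).primeCounting := by
  have h1 : ∀ᶠ x : ℝ in Filter.atTop, ‖Real.log x‖ ≤ 1 / 100 * ‖x‖ :=
    Real.isLittleO_log_id_atTop.def (by norm_num)
  filter_upwards [tendsto_natCast_atTop_atTop.eventually h1, Filter.eventually_ge_atTop 100]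
    with m hm h100
  have h100' : (100 : ℝ) ≤ m := by exact_mod_cast h100
  have hpos : (0 : ℝ) < m := by linarith
  have hlog : 0 < Real.log m := Real.log_pos (by linarith)
  rw [Real.norm_of_nonneg hlog.le, Real.norm_of_nonneg hpos.le] at hm
  have h2 := Chebyshev.pi_ge (m ^ 2)
  push_cast at h2
  have h3 : Real.log ((m : ℝ) ^ 2 + 1) ≤ 3 * Real.log m := by
    rw [← Real.log_rpow hpos]
    refine Real.log_le_log (by positivity) ?_
    norm_cast
    nlinarith [Nat.mul_le_mul h100 (Nat.mul_le_mul h100 h100)]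
  rw [div_le_iff₀ (Real.log_pos (by nlinarith)), Real.log_pow] at h2
  push_cast at h2
  have h4 := Real.log_two_gt_d9
  by_contra! hcon
  have h5 : (((m ^ 2).primeCounting : ℕ) : ℝ) < 3 * m := by exact_mod_cast hcon
  have h6 : (((m ^ 2).primeCounting : ℕ) : ℝ) * (2 * Real.log m) ≤ 3 * m * (2 * (1 / 100 * m)) := by
    gcongr
  nlinarith [mul_pos hpos hpos]

/-- Conditions for k = 7, N = d·m ≤ m⁶ and M^(14m) ≤ 2 in the pigeonhole step; 588 = 6·7·14. -/
theorem eventually_dobrowolski_parameters :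
    ∀ᶠ m : ℕ in Filter.atTop, 16 ≤ m ∧ 3 * m ≤ (m ^ 2).primeCounting ∧
      (8 * ((m : ℝ) ^ 6) ^ 7) ^ 14 * 2 < 2 ^ m ∧ (m + 1) ^ 4 ≤ m ^ 5 ∧ (m + 1) ^ 4 ≤ 2 ^ m := by
  have h1 : ∀ᶠ m : ℕ in Filter.atTop, (m : ℝ) ^ 588 / 2 ^ m < 1 / (8 ^ 14 * 2) :=
    (tendsto_pow_const_div_const_pow_of_one_lt 588 (one_lt_two)).eventually_lt_const (by positivity)
  filter_upwards [h1, eventually_three_mul_le_primeCounting_sq, Filter.eventually_ge_atTop 16]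
    with m hm hp h16
  have h3 : (m + 1) ^ 4 ≤ m ^ 5 := by
    calc (m + 1) ^ 4 ≤ (2 * m) ^ 4 := by gcongr; omega
      _ = 16 * m ^ 4 := by ring
      _ ≤ m * m ^ 4 := by gcongr
      _ = m ^ 5 := by ring
  have h2 : (8 * ((m : ℝ) ^ 6) ^ 7) ^ 14 * 2 < 2 ^ m := by
    rw [div_lt_iff₀ (by positivity), div_mul_eq_mul_div, one_mul,
      lt_div_iff₀ (by positivity)] at hm
    calc _ = (m : ℝ) ^ 588 * (8 ^ 14 * 2) := by ring
      _ < _ := hm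
  refine ⟨h16, hp, h2, h3, h3.trans ?_⟩
  have h1m : (1 : ℝ) ≤ m := by exact_mod_cast (by omega : 1 ≤ m)
  have : (m : ℝ) ^ 5 ≤ 2 ^ m := by
    refine le_trans ?_ h2.le
    calc (m : ℝ) ^ 5 ≤ (m : ℝ) ^ 588 := pow_le_pow_right₀ h1m (by norm_num)
      _ ≤ (8 ^ 14 * 2) * (m : ℝ) ^ 588 := le_mul_of_one_le_left (by positivity) (by norm_num)
      _ = _ := by ring
  exact_mod_cast this

theorem sub_le_card_primes_Ioc (m n : ℕ) :
    n.primeCounting - m ≤ ((Finset.Ioc m n).filter Nat.Prime).card := by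
  have h : n.primeCounting = ((Finset.Icc 1 n).filter Nat.Prime).card := by
    rw [Nat.primeCounting, Nat.primeCounting', Nat.count_eq_card_filter_range]
    congr 1
    ext p
    simp only [Finset.mem_filter, Finset.mem_range, Finset.mem_Icc]
    constructor
    · exact fun ⟨h1, h2⟩ => ⟨⟨h2.one_lt.le, by omega⟩, h2⟩
    · exact fun ⟨h1, h2⟩ => ⟨by omega, h2⟩
  have h2 : (Finset.Icc 1 n).filter Nat.Prime ⊆
      Finset.Icc 1 m ∪ (Finset.Ioc m n).filter Nat.Prime := fun p hp => by
    simp only [Finset.mem_filter, Finset.mem_Icc, Finset.mem_union, Finset.mem_Ioc] at hp ⊢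
    by_cases p ≤ m
    · exact Or.inl ⟨hp.1.1, by omega⟩
    · exact Or.inr ⟨⟨by omega, hp.1.2⟩, hp.2⟩
  have h3 := (Finset.card_le_card h2).trans (Finset.card_union_le _ _)
  rw [Nat.card_Icc] at h3
  omega

/-- A polynomial lower bound for the logarithm of the Mahler measure. -/
theorem eventually_one_lt_mul_log_intMahlerMeasure :
    ∀ᶠ m : ℕ in Filter.atTop, ∀ P : ℤ[X], P.Monic → Irreducible P →
      0 < Real.log (intMahlerMeasure P) → m ^ 4 ≤ P.natDegree → P.natDegree < (m + 1) ^ 4 →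
        1 < 2 * (m : ℝ) ^ 3 * Real.log (intMahlerMeasure P) := by
  filter_upwards [eventually_dobrowolski_parameters] with m ⟨h16, hpi, hpig, h5, h2m⟩ P hm hi hM
    hd1 hd2
  by_contra! hcon
  have h16' : (16 : ℝ) ≤ m := by exact_mod_cast h16
  have hm0 : (0 : ℝ) < m := by linarith
  have hd : 2 ≤ P.natDegree := by
    have : m ^ 1 ≤ m ^ 4 := Nat.pow_le_pow_right (by omega) (by norm_num)
    rw [pow_one] at this
    omega
  set N := P.natDegree * m with hN
  have hNpos : 0 < N := Nat.mul_pos (by omega) (by omega)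
  have hN6 : N ≤ m ^ 6 := by
    calc N ≤ m ^ 5 * m := Nat.mul_le_mul_right _ (hd2.le.trans h5)
      _ = m ^ 6 := by ring
  have hN6' : (N : ℝ) ≤ m ^ 6 := by exact_mod_cast hN6
  have hMpos : 0 < intMahlerMeasure P := by
    rw [intMahlerMeasure_eq_prod hm hi]
    exact Finset.prod_pos fun _ _ => by positivity
  -- Under the contrary assumption n·log M ≤ 1/2 < log 2.
  have hpow : ∀ n : ℕ, (n : ℝ) ≤ m ^ 3 → intMahlerMeasure P ^ n < 2 := fun n hn => by
    rw [← Real.log_lt_log_iff (by positivity) two_pos, Real.log_pow]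
    have := Real.log_two_gt_d9
    have : n * Real.log (intMahlerMeasure P) ≤ m ^ 3 * Real.log (intMahlerMeasure P) := by gcongr
    linarith
  obtain ⟨F, hF0, hFd, hFc, hPF⟩ := exists_pow_dvd_of_small_coeff hm hi (k := 7) hNpos (by
    calc ((8 * (N : ℝ) ^ 7) ^ (2 * 7)) ^ P.natDegree * intMahlerMeasure P ^ (2 * 7 * N)
        = ((8 * (N : ℝ) ^ 7) ^ 14 * intMahlerMeasure P ^ (14 * m)) ^ P.natDegree := by
          rw [mul_pow ((8 * (N : ℝ) ^ 7) ^ 14), ← pow_mul (intMahlerMeasure P),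
            show 14 * m * P.natDegree = 2 * 7 * N by rw [hN]; ring]
      _ < (2 ^ m) ^ P.natDegree := by
          refine pow_lt_pow_left₀ (lt_of_le_of_lt ?_ hpig) (by positivity) (by omega)
          gcongr
          refine (hpow _ ?_).le
          push_cast
          nlinarith [mul_pos hm0 hm0]
      _ = 2 ^ N := by rw [← pow_mul, hN, mul_comm])
  -- Of the 3m primes up to m², at least 2m exceed m: m outnumber the zeros of F, and m absorb the
  -- bad primes since d < 2^m.
  obtain ⟨p, hp, hnd⟩ := exists_not_dvd_expand hm hi hd (exists_one_lt_norm hm hi hM)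
    (T := (Finset.Ioc m (m ^ 2)).filter Nat.Prime) (fun p hp => (Finset.mem_filter.1 hp).2)
    (b := m) (m := m) (hd2.trans_le h2m)
    ((by omega : m + m ≤ (m ^ 2).primeCounting - m).trans (sub_le_card_primes_Ioc _ _)) hF0 hFd
  obtain ⟨hpI, hpp⟩ := Finset.mem_filter.1 hp
  obtain ⟨hp1, hp2⟩ := Finset.mem_Ioc.1 hpI
  have hlow := pow_le_prod_norm_aeval_pow hm hi hpp hPF hnd
  have hup : ∏ a ∈ complexZeros P, ‖aeval (a ^ p) F‖ ≤
      (N * intMahlerMeasure P ^ (p * m)) ^ P.natDegree := by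
    have e : (N * intMahlerMeasure P ^ (p * m)) ^ P.natDegree =
        ∏ a ∈ complexZeros P, (N : ℝ) * (max 1 ‖a‖ ^ p) ^ N := by
      rw [Finset.prod_mul_distrib, Finset.prod_const, card_complexZeros hm hi, mul_pow,
        Finset.prod_pow, Finset.prod_pow, ← intMahlerMeasure_eq_prod hm hi, ← pow_mul, ← pow_mul,
        hN]
      congr 2
      ring
    rw [e]
    refine Finset.prod_le_prod (fun _ _ => norm_nonneg _) fun a _ => ?_
    refine (norm_aeval_le_of_coeff_le hFd hFc _).trans ?_
    rw [mul_one]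
    gcongr
    rw [norm_pow]
    exact max_le (one_le_pow₀ (le_max_left _ _)) (by gcongr; exact le_max_right _ _)
  -- Taking d-th roots leads to m⁷ ≤ p⁷ ≤ 2m⁶, absurd for m ≥ 16.
  have h1 : (p : ℝ) ^ 7 ≤ N * intMahlerMeasure P ^ (p * m) := by
    refine le_of_pow_le_pow_left₀ (n := P.natDegree) (by omega) (by positivity) ?_
    rw [← pow_mul]
    exact hlow.trans hup
  have h2 : intMahlerMeasure P ^ (p * m) < 2 := by
    refine hpow _ ?_
    have : p * m ≤ m ^ 3 := by
      calc p * m ≤ m ^ 2 * m := Nat.mul_le_mul_right _ hp2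
        _ = m ^ 3 := by ring
    exact_mod_cast this
  have h3 : (m : ℝ) ^ 7 ≤ (p : ℝ) ^ 7 := by gcongr
  have h4 : (N : ℝ) * intMahlerMeasure P ^ (p * m) ≤ m ^ 6 * 2 := by gcongr
  have h6 : (m : ℝ) ^ 6 * 16 ≤ m ^ 7 := by
    rw [pow_succ (m : ℝ) 6]; gcongr
  have : (0 : ℝ) < m ^ 6 := by positivity
  linarith

/-! ### Conclusion -/

theorem goldenConst_nonneg : 0 ≤ goldenConst := by
  have h : 1 ≤ (1 + Real.sqrt 5) / 2 := by
    have : 1 ≤ Real.sqrt 5 := Real.one_le_sqrt.2 (by norm_num)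
    linarith
  have := Real.log_nonneg h
  have := Real.pi_pos
  unfold goldenConst
  positivity

theorem goldenConst_le_one : goldenConst ≤ 1 := by
  have h5 : Real.sqrt 5 ≤ 3 := Real.sqrt_le_iff.2 ⟨by norm_num, by norm_num⟩
  have h0 : 0 ≤ Real.sqrt 5 := Real.sqrt_nonneg 5
  have h : Real.log ((1 + Real.sqrt 5) / 2) ≤ 1 := by
    have := Real.log_le_sub_one_of_pos (by positivity : 0 < (1 + Real.sqrt 5) / 2)
    linarith
  have hpi := Real.pi_gt_three
  have h2 : 2 / Real.pi ≤ 1 := by rw [div_le_one Real.pi_pos]; linarith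
  have h3 : 0 ≤ 2 / Real.pi := by positivity
  unfold goldenConst
  nlinarith

theorem exists_pow_four_bracket (d : ℕ) : ∃ m : ℕ, m ^ 4 ≤ d ∧ d < (m + 1) ^ 4 := by
  refine ⟨Nat.sqrt (Nat.sqrt d), ?_, ?_⟩
  · have h1 := Nat.sqrt_le' d
    have h2 := Nat.sqrt_le' (Nat.sqrt d)
    calc _ = (Nat.sqrt (Nat.sqrt d) ^ 2) ^ 2 := by ring
      _ ≤ Nat.sqrt d ^ 2 := by gcongr
      _ ≤ d := h1
  · have h1 := Nat.lt_succ_sqrt' d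
    have h2 := Nat.lt_succ_sqrt' (Nat.sqrt d)
    calc d < (Nat.sqrt d + 1) ^ 2 := h1
      _ ≤ ((Nat.sqrt (Nat.sqrt d) + 1) ^ 2) ^ 2 := by gcongr; exact h2
      _ = _ := by ring

/-- With m⁴ ≤ d, d·log M ≥ m·(m³ log M) > m/2, which is unbounded. -/
theorem exists_le_natDegree_mul_log (κ : ℝ) (hκ : 0 < κ) :
    ∃ D : ℕ, ∀ P : ℤ[X], P.Monic → Irreducible P → 0 < Real.log (intMahlerMeasure P) →
      D ≤ P.natDegree → 1 ≤ κ ^ 2 * (P.natDegree * Real.log (intMahlerMeasure P)) := by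
  obtain ⟨m₀, hm₀⟩ := Filter.eventually_atTop.1 eventually_one_lt_mul_log_intMahlerMeasure
  obtain ⟨m₁, hm₁⟩ := exists_nat_ge (2 / κ ^ 2)
  refine ⟨(max m₀ m₁ + 1) ^ 4, fun P hm hi hM hD => ?_⟩
  obtain ⟨m, h1, h2⟩ := exists_pow_four_bracket P.natDegree
  have h3 : max m₀ m₁ ≤ m :=
    Nat.le_of_lt_succ (lt_of_pow_lt_pow_left₀ 4 (Nat.zero_le _) (lt_of_le_of_lt
      (Nat.pow_le_pow_left (Nat.le_succ _) 4) (hD.trans_lt h2)))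
  have h4 := hm₀ m ((le_max_left _ _).trans h3) P hm hi hM h1 h2
  have h5 : 2 / κ ^ 2 ≤ m := hm₁.trans (by exact_mod_cast (le_max_right m₀ m₁).trans h3)
  rw [div_le_iff₀ (by positivity)] at h5
  have h6 : (m : ℝ) ^ 4 ≤ P.natDegree := by exact_mod_cast h1
  calc (1 : ℝ) ≤ 2 * (m : ℝ) ^ 3 * Real.log (intMahlerMeasure P) := h4.le
    _ ≤ (m * κ ^ 2) * (m : ℝ) ^ 3 * Real.log (intMahlerMeasure P) := by gcongr
    _ = κ ^ 2 * ((m : ℝ) ^ 4 * Real.log (intMahlerMeasure P)) := by ring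
    _ ≤ _ := by gcongr

theorem mainTheorem1 (φ : ℕ → ℝ)
    (hφ : Asymptotics.IsLittleO Filter.atTop φ (fun d : ℕ => (d : ℝ) / Real.log (d : ℝ)))
    (ε : ℝ) (hε : 0 < ε) :
    ∃ D₀ : ℕ, ∀ P : Polynomial ℤ, P.Monic → Irreducible P →
      0 < Real.log (intMahlerMeasure P) →
      Real.log (intMahlerMeasure P) ≤ φ P.natDegree →
      D₀ ≤ P.natDegree →
        (goldenConst - ε) *
            Real.sqrt ((P.natDegree : ℝ) /
              (Real.log (P.natDegree : ℝ) * Real.log (intMahlerMeasure P)))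
          ≤ ((zerosNear P 1).ncard : ℝ) ∧
        (ε < goldenConst →
          0 < minZeroCount P ∧
          (goldenConst - ε) ^ 2 *
              ((P.natDegree : ℝ) /
                ((minZeroCount P : ℝ) ^ 2 * Real.log (P.natDegree : ℝ)))
            ≤ Real.log (intMahlerMeasure P)) := by
  obtain ⟨κ₁, η₁, hκ₁, hη₁, D₁, h₁⟩ := exists_linear_zero_count monic_smallAwayFromOne.ne_zero
    (c := 1) fun z => norm_smallAwayFromOne_lt
  obtain ⟨κ₂, η₂, hκ₂, hη₂, D₂, h₂⟩ := exists_linear_zero_count smallAwayFromOne_comp_neg_ne_zero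
    (c := -1) fun z => norm_smallAwayFromOne_neg_lt
  set κ := min κ₁ κ₂ with hκ
  set η := min η₁ η₂ with hη
  have hκ0 : 0 < κ := lt_min hκ₁ hκ₂
  have hη0 : 0 < η := lt_min hη₁ hη₂
  obtain ⟨D₃, h₃⟩ := exists_le_natDegree_mul_log κ hκ0
  obtain ⟨D₄, h₄⟩ := Filter.eventually_atTop.1 (hφ.def hη0)
  refine ⟨max (max D₁ D₂) (max (max D₃ D₄) 3), fun P hm hi hM hMφ hD => ?_⟩
  simp only [max_le_iff] at hD
  obtain ⟨⟨hD₁, hD₂⟩, ⟨hD₃, hD₄⟩, hd3⟩ := hD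
  have hd3' : (3 : ℝ) ≤ P.natDegree := by exact_mod_cast hd3
  have hlogd : 1 ≤ Real.log P.natDegree := by
    rw [Real.le_log_iff_exp_le (by linarith)]
    exact Real.exp_one_lt_three.le.trans hd3'
  have hMη : Real.log (intMahlerMeasure P) ≤ η * P.natDegree := by
    have h5 := h₄ _ hD₄
    rw [Real.norm_eq_abs, Real.norm_of_nonneg (by positivity)] at h5
    calc Real.log (intMahlerMeasure P) ≤ η * (P.natDegree / Real.log P.natDegree) :=
          hMφ.trans ((le_abs_self _).trans h5)
      _ ≤ η * P.natDegree := by gcongr; exact div_le_self (by positivity) hlogd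
  have hη1 : η * P.natDegree ≤ η₁ * P.natDegree := by gcongr; exact min_le_left _ _
  have hη2 : η * P.natDegree ≤ η₂ * P.natDegree := by gcongr; exact min_le_right _ _
  have hZ1 : κ * P.natDegree ≤ (zerosNear P 1).ncard :=
    le_trans (by gcongr; exact min_le_left _ _) (h₁ P hm hi hD₁ (hMη.trans hη1))
  have hZ2 : κ * P.natDegree ≤ (zerosNear P (-1)).ncard :=
    le_trans (by gcongr; exact min_le_right _ _) (h₂ P hm hi hD₂ (hMη.trans hη2))
  have hmain := h₃ P hm hi hM hD₃
  have hC0 := goldenConst_nonneg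
  have hC1 := goldenConst_le_one
  set d : ℝ := (P.natDegree : ℝ) with hd
  set L := Real.log (intMahlerMeasure P) with hL
  have hd0 : 0 < d := by linarith
  constructor
  -- After squaring this reads 1 ≤ κ²·(d·log M)·log d, which follows from `hmain` and log d ≥ 1.
  · have hsq : Real.sqrt (d / (Real.log d * L)) ≤ κ * d := by
      rw [Real.sqrt_le_left (by positivity), div_le_iff₀ (by positivity)]
      calc d ≤ κ ^ 2 * (d * L) * (d * Real.log d) := by
            have : d * 1 ≤ d * Real.log d := by gcongr
            nlinarith
        _ = _ := by ring
    calc (goldenConst - ε) * Real.sqrt (d / (Real.log d * L))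
        ≤ 1 * Real.sqrt (d / (Real.log d * L)) := by gcongr; linarith
      _ ≤ κ * d := by rwa [one_mul]
      _ ≤ _ := hZ1
  · intro hεC
    have hK : κ * d ≤ (minZeroCount P : ℝ) := by
      rw [minZeroCount, Nat.cast_min]
      exact le_min hZ1 hZ2
    have hK0 : (0 : ℝ) < minZeroCount P := lt_of_lt_of_le (by positivity) hK
    refine ⟨by exact_mod_cast hK0, ?_⟩
    have hsq : (goldenConst - ε) ^ 2 ≤ 1 := pow_le_one₀ (by linarith) (by linarith)
    calc (goldenConst - ε) ^ 2 * (d / ((minZeroCount P : ℝ) ^ 2 * Real.log d))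
        ≤ 1 * (d / ((κ * d) ^ 2 * 1)) := by gcongr
      _ = 1 / (κ ^ 2 * d) := by field_simp
      _ ≤ L := by
          rw [div_le_iff₀ (by positivity)]
          calc (1 : ℝ) ≤ κ ^ 2 * (d * L) := hmain
            _ = _ := by ring
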